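/- \textbf{Theorem (Free-Support Barycenter).} A metric measure space (mm-space) is a triple $\mathbb X=(X,d,\mu)$ consisting of a compact metric space $(X,d)$ and a Borel probability measure $\mu$ on $X$. For probability measures $\mu_1,\dots,\mu_N$ on $X_1,\dots,X_N$ let $\Pi(\mu_1,\dots,\mu_N)$ be the set of Borel probability measures on $X_1\times\dots\times X_N$ with marginals $\mu_1,\dots,\mu_N$. The Gromov--Wasserstein distance of $\mathbb X_1=(X_1,d_1,\mu_1)$ and $\mathbb X_2=(X_2,d_2,\mu_2)$ is $$\mathrm{GW}(\mathbb X_1,\mathbb X_2)=\inf_{\pi\in\Pi(\mu_1,\mu_2)}\Big(\int_{(X_1\times X_2)^2}|d_1(x_1,x_1')-d_2(x_2,x_2')|^2\,\mathrm d\pi(x_1,x_2)\,\mathrm d\pi(x_1',x_2')\Big)^{1/2}.$$ Two mm-spaces $(X,d_X,\mu)$ and $(Y,d_Y,\nu)$ are called isomorphic if there is a surjective isometry between the supports, $\mathcal I\colon\operatorname{supp}\mu\to\operatorname{supp}\nu$, with $\mathcal I_\#\mu=\nu$. Let $\mathbb X_i=(X_i,d_i,\mu_i)$, $i=1,\dots,N$,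 be mm-spaces, and let $\rho_i\ge 0$ be weights with $\sum_{i=1}^N\rho_i=1$. Then the infimum $$\inf_{\mathbb Y}\ \sum_{i=1}^N\rho_i\,\mathrm{GW}^2(\mathbb X_i,\mathbb Y)$$ over all mm-spaces $\mathbb Y$ is attained. Moreover, for each minimizer $\mathbb Y$ there is a minimizer $\pi^*$ of the multi-marginal Gromov--Wasserstein problem $$\inf_{\pi\in\Pi(\mu_1,\dots,\mu_N)}\int_{\boldsymbol X^2}c(\boldsymbol x,\boldsymbol x')\,\mathrm d\pi(\boldsymbol x)\,\mathrm d\pi(\boldsymbol x'),\qquad c(\boldsymbol x,\boldsymbol x')=\frac12\sum_{i,j=1}^N\rho_i\rho_j\,|d_i(x_i,x_i')-d_j(x_j,x_j')|^2,$$ with $\boldsymbol X=X_1\times\dots\times X_N$, such that $\mathbb Y$ is isomorphic to $(\boldsymbol X,d^*,\pi^*)$, where $d^*(\boldsymbol x,\boldsymbol x')=\sum_{i=1}^N\rho_i\,d_i(x_i,x_i')$. Here, if some of the weights vanish, so that $d^*$ is only a pseudometric, $(\boldsymbol X,d^*,\pi^*)$ denotes the quotient metric space of $(\boldsymbol X,d^*)$,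 in which points at $d^*$-distance zero are identified, with the push-forward of $\pi^*$ under the quotient map; if all $\rho_i>0$, then $d^*$ is a metric and nothing is identified. -/

import Mathlib

open MeasureTheory
open scoped NNReal

universe u

namespace GromovWasserstein

/-- A metric measure space: a compact metric space with a Borel probability measure. -/
structure MMSpace : Type (u + 1) where
  carrier : Type u
  [metricSpace : MetricSpace carrier]
  [compactSpace : CompactSpace carrier]
  [measurableSpace : MeasurableSpace carrier]
  [borelSpace : BorelSpace carrier]
  μ : ProbabilityMeasure carrier

namespace MMSpace

instance : CoeSort MMSpace.{u} (Type u) := ⟨MMSpace.carrier⟩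

attribute [instance] metricSpace compactSpace measurableSpace borelSpace

/-- Two mm-spaces are isomorphic if there is a measure-preserving isometry between them. As usual
for measures that need not have full support, the isometry is one between the supports
(the points outside of the support do not matter). If both measures have full support, the
supports are the whole spaces. -/
def Isomorphic (X Y : MMSpace.{u}) : Prop :=
  ∃ e : (X.μ : Measure X).support ≃ᵢ (Y.μ : Measure Y).support,
    ((X.μ : Measure X).comap Subtype.val).map e = (Y.μ : Measure Y).comap Subtype.val

end MMSpace

/-- The transport plans between two mm-spaces: probability measures on the product with the
given marginals. -/
def couplings (X Y : MMSpace.{u}) : Set (ProbabilityMeasure (X × Y)) :=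
  {π | (π : Measure (X × Y)).map Prod.fst = X.μ ∧ (π : Measure (X × Y)).map Prod.snd = Y.μ}

/-- The Gromov--Wasserstein distance. -/
noncomputable def GW (X Y : MMSpace.{u}) : ℝ :=
  sInf ((fun π : ProbabilityMeasure (X × Y) =>
    Real.sqrt (∫ p : (X × Y) × (X × Y), |dist p.1.1 p.2.1 - dist p.1.2 p.2.2| ^ 2
      ∂((π : Measure (X × Y)).prod (π : Measure (X × Y))))) '' couplings X Y)

section Multi

variable {N : ℕ} (X : Fin N → MMSpace.{u})

/-- The multi-marginal transport plans: probability measures on `X₁ × ⋯ × X_N` with the given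
marginals. -/
def multiCouplings : Set (ProbabilityMeasure (∀ i, X i)) :=
  {π | ∀ i, (π : Measure (∀ i, X i)).map (fun x => x i) = (X i).μ}

/-- The objective of the multi-marginal GW transport problem with cost function `c`. -/
noncomputable def mgwObjective (c : (∀ i, X i) → (∀ i, X i) → ℝ)
    (π : ProbabilityMeasure (∀ i, X i)) : ℝ :=
  ∫ p : (∀ i, X i) × (∀ i, X i), c p.1 p.2
    ∂((π : Measure (∀ i, X i)).prod (π : Measure (∀ i, X i)))

/-- `π` is a minimizer (optimal plan) of the multi-marginal GW transport problem with cost `c`. -/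
def IsMGWMinimizer (c : (∀ i, X i) → (∀ i, X i) → ℝ) (π : ProbabilityMeasure (∀ i, X i)) : Prop :=
  π ∈ multiCouplings X ∧ ∀ γ ∈ multiCouplings X, mgwObjective X c π ≤ mgwObjective X c γ

variable (ρ : Fin N → ℝ≥0)

/-- The cost `½ ∑ᵢⱼ ρᵢ ρⱼ |dᵢ(xᵢ, xᵢ') - dⱼ(xⱼ, xⱼ')|²`. -/
noncomputable def baryCost (x x' : ∀ i, X i) : ℝ :=
  (1 / 2 : ℝ) * ∑ i, ∑ j, (ρ i : ℝ) * (ρ j : ℝ) *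
    |dist (x i) (x' i) - dist (x j) (x' j)| ^ 2

/-- The objective `∑ᵢ ρᵢ GW²(Xᵢ, Y)` of the barycenter problem. -/
noncomputable def baryObjective (Y : MMSpace.{u}) : ℝ :=
  ∑ i, (ρ i : ℝ) * GW (X i) Y ^ 2

/-- `Y` is a GW barycenter: it minimizes the barycenter objective among all mm-spaces. -/
def IsBarycenter (Y : MMSpace.{u}) : Prop :=
  ∀ Z : MMSpace.{u}, baryObjective X ρ Y ≤ baryObjective X ρ Z

/-- The product `X₁ × ⋯ × X_N`, to be equipped with `d*` in place of the product metric. -/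
structure WeightedProduct (ρ : Fin N → ℝ≥0) : Type u where
  point : ∀ i, X i

/-- The pseudometric `d*(x, x') = ∑ᵢ ρᵢ dᵢ(xᵢ, xᵢ')` (a metric if all weights are positive). -/
noncomputable instance : PseudoMetricSpace (WeightedProduct X ρ) where
  dist x x' := ∑ i, (ρ i : ℝ) * dist (x.point i) (x'.point i)
  dist_self x := by simp
  dist_comm x y := by simp only [dist_comm]
  dist_triangle x y z := by
    rw [← Finset.sum_add_distrib]
    refine Finset.sum_le_sum fun i _ => ?_
    rw [← mul_add]
    exact mul_le_mul_of_nonneg_left (dist_triangle _ _ _) (ρ i).2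

/-- The metric space of `(X₁ × ⋯ × X_N, d*)`: points at `d*`-distance zero are identified. If all
weights are positive, `d*` is a metric and nothing is identified. -/
abbrev StarCarrier : Type u := SeparationQuotient (WeightedProduct X ρ)

/-- The canonical map from the product to `(X₁ × ⋯ × X_N, d*)`. -/
noncomputable def toStar (x : ∀ i, X i) : StarCarrier X ρ :=
  SeparationQuotient.mk ⟨x⟩

theorem dist_toStar (x x' : ∀ i, X i) :
    dist (toStar X ρ x) (toStar X ρ x') = ∑ i, (ρ i : ℝ) * dist (x i) (x' i) := rfl

theorem continuous_toStar : Continuous (toStar X ρ) := by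
  rw [continuous_iff_continuousAt]
  intro a
  rw [ContinuousAt, tendsto_iff_dist_tendsto_zero]
  simp only [dist_toStar]
  have h : Continuous fun x : ∀ i, X i => ∑ i, (ρ i : ℝ) * dist (x i) (a i) := by fun_prop
  simpa using h.tendsto a

theorem surjective_toStar : Function.Surjective (toStar X ρ) := by
  intro y
  obtain ⟨⟨x⟩, rfl⟩ := SeparationQuotient.surjective_mk y
  exact ⟨x, rfl⟩

theorem injective_toStar (h : ∀ i, 0 < ρ i) : Function.Injective (toStar X ρ) := by
  intro x x' hxx
  have h0 : ∑ i, (ρ i : ℝ) * dist (x i) (x' i) = 0 := by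
    rw [← dist_toStar, hxx, dist_self]
  funext i
  have h1 := (Finset.sum_eq_zero_iff_of_nonneg
    (fun i _ => mul_nonneg (ρ i).2 dist_nonneg)).1 h0 i (Finset.mem_univ i)
  rcases mul_eq_zero.1 h1 with h2 | h2
  · exact absurd h2 (NNReal.coe_ne_zero.2 (h i).ne')
  · exact dist_eq_zero.1 h2

instance : CompactSpace (StarCarrier X ρ) :=
  (surjective_toStar X ρ).compactSpace (continuous_toStar X ρ)

/-- The Borel σ-algebra of `d*`. -/
noncomputable instance : MeasurableSpace (StarCarrier X ρ) := borel _

instance : BorelSpace (StarCarrier X ρ) := ⟨rfl⟩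

theorem measurable_toStar : Measurable (toStar X ρ) :=
  (continuous_toStar X ρ).measurable

/-- The mm-space `(X₁ × ⋯ × X_N, d*, π)` (with `π` transported along the canonical map). -/
noncomputable def starSpace (π : ProbabilityMeasure (∀ i, X i)) : MMSpace.{u} where
  carrier := StarCarrier X ρ
  μ := π.map (measurable_toStar X ρ).aemeasurable

end Multi

end GromovWasserstein

/-! For real `a i` and weights summing to one, the weighted mean square distance of the `a i` to a
number `t` is their variance plus the squared distance of their mean to `t` (`sum_mul_sub_sq`). With
`a i = dist (x i) (x' i)`, the variance is `baryCost` and the mean is `d*`.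

Given `Y`, optimal plans between each `X i` and `Y` exist by weak compactness and can be glued along
`Y` (`exists_gluing`). Integrating the identity with `t = dist y y'` shows that the barycenter
objective of `Y` is the multi-marginal cost of the glued plan plus a nonnegative distortion between
`Y` and `d*` (`exists_plan_baryObjective_eq`). Conversely, for a multi-marginal plan, choosing `t`
as `d*` itself removes the distortion (`baryObjective_starSpace_le`). Both infima therefore agree,
and minimal plans yield barycenters.

If `Y` is a barycenter, the distortion vanishes. The two distances then agree on the support of the
glued measure, which gives the isomorphism (`exists_isometryEquiv_support`). -/

namespace GromovWasserstein

open ProbabilityTheory Filter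

/-! ### Quadratic functionals of measures and weak compactness -/

section Integrals

variable {Ω Ω' : Type*} [TopologicalSpace Ω] [MeasurableSpace Ω] [BorelSpace Ω]
  [TopologicalSpace Ω'] [MeasurableSpace Ω'] [BorelSpace Ω']

/-- A continuous function on the square of a compact space is integrable. -/
theorem integrable_prod_self [CompactSpace Ω] [SecondCountableTopology Ω] (γ : Measure Ω) [IsProbabilityMeasure γ] {c : Ω × Ω → ℝ}
    (hc : Continuous c) : Integrable c (γ.prod γ) :=
  hc.integrable_of_hasCompactSupport (HasCompactSupport.of_compactSpace c)

theorem integral_prod_self_map [SecondCountableTopology Ω'] (γ : Measure Ω) [IsProbabilityMeasure γ] {f : Ω → Ω'}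
    (hf : Continuous f) {c : Ω' × Ω' → ℝ} (hc : Continuous c) :
    ∫ p, c p ∂((γ.map f).prod (γ.map f)) = ∫ p : Ω × Ω, c (f p.1, f p.2) ∂(γ.prod γ) := by
  rw [Measure.map_prod_map _ _ hf.measurable hf.measurable,
    integral_map (hf.measurable.prodMap hf.measurable).aemeasurable
      hc.measurable.aestronglyMeasurable]
  rfl

/-- The quadratic functional of a continuous kernel is weakly continuous. -/
theorem continuous_integral_prod_self [CompactSpace Ω] [SecondCountableTopology Ω]
    [TopologicalSpace.PseudoMetrizableSpace Ω] {c : Ω × Ω → ℝ} (hc : Continuous c) :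
    Continuous fun π : ProbabilityMeasure Ω => ∫ p, c p ∂((π : Measure Ω).prod (π : Measure Ω)) := by
  have h1 : Continuous fun π : ProbabilityMeasure Ω => π.prod π :=
    ProbabilityMeasure.continuous_prod.comp (continuous_id.prodMk continuous_id)
  exact (ProbabilityMeasure.continuous_integral_continuousMap (⟨c, hc⟩ : C(Ω × Ω, ℝ))).comp h1

/-- The probability measures on a compact metrizable space are weakly compact, and the functional is
weakly continuous. -/
theorem exists_minimizer_integral_prod_self [CompactSpace Ω] [SecondCountableTopology Ω]
    [TopologicalSpace.MetrizableSpace Ω] {c : Ω × Ω → ℝ} (hc : Continuous c)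
    {S : Set (ProbabilityMeasure Ω)} (hS : IsClosed S) (hne : S.Nonempty) :
    ∃ π ∈ S, ∀ γ ∈ S, ∫ p, c p ∂((π : Measure Ω).prod (π : Measure Ω)) ≤
      ∫ p, c p ∂((γ : Measure Ω).prod (γ : Measure Ω)) :=
  hS.isCompact.exists_isMinOn hne (continuous_integral_prod_self hc).continuousOn

theorem isClosed_setOf_map_eq [TopologicalSpace.PseudoMetrizableSpace Ω'] {f : Ω → Ω'}
    (hf : Continuous f) (μ : ProbabilityMeasure Ω') :
    IsClosed {π : ProbabilityMeasure Ω | (π : Measure Ω).map f = μ} := by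
  have h : {π : ProbabilityMeasure Ω | (π : Measure Ω).map f = μ} =
      (fun π : ProbabilityMeasure Ω => π.map hf.measurable.aemeasurable) ⁻¹' {μ} := by
    ext π
    simp only [Set.mem_ofPred_eq, Set.mem_preimage, Set.mem_singleton_iff]
    exact ⟨fun h => Subtype.ext h, fun h => congrArg Subtype.val h⟩
  rw [h]
  exact isClosed_singleton.preimage (ProbabilityMeasure.continuous_map hf)

end Integrals

/-! ### Gluing couplings along a common marginal -/

section Gluing

variable {N : ℕ} {A : Fin N → Type*} [∀ i, MeasurableSpace (A i)] {B : Type*} [MeasurableSpace B]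

/-- The product of finitely many Markov kernels with the same source. -/
noncomputable def piKernel (κ : ∀ i, Kernel B (A i)) [∀ i, IsMarkovKernel (κ i)] :
    Kernel B (∀ i, A i) where
  toFun b := Measure.pi fun i => κ i b
  measurable' := by
    refine Measurable.measure_of_isPiSystem_of_isProbabilityMeasure generateFrom_pi.symm
      isPiSystem_pi ?_
    rintro _ ⟨s, hs, rfl⟩
    simp only [Measure.pi_pi]
    exact Finset.measurable_prod _ fun i _ => (κ i).measurable_coe (hs i (Set.mem_univ i))

theorem piKernel_apply (κ : ∀ i, Kernel B (A i)) [∀ i, IsMarkovKernel (κ i)] (b : B) :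
    piKernel κ b = Measure.pi fun i => κ i b := rfl

instance (κ : ∀ i, Kernel B (A i)) [∀ i, IsMarkovKernel (κ i)] :
    IsMarkovKernel (piKernel κ) :=
  ⟨fun b => by rw [piKernel_apply]; infer_instance⟩

theorem piKernel_map_eval (κ : ∀ i, Kernel B (A i)) [∀ i, IsMarkovKernel (κ i)] (i : Fin N) :
    (piKernel κ).map (fun x => x i) = κ i := by
  ext1 b
  rw [Kernel.map_apply _ (measurable_pi_apply i), piKernel_apply]
  exact (measurePreserving_eval (fun i => κ i b) i).map_eq

/-- Finitely many couplings with the same second marginal can be glued along it. -/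
theorem exists_gluing [∀ i, StandardBorelSpace (A i)] (ν : Measure B) [IsProbabilityMeasure ν]
    (π : ∀ i, Measure (A i × B)) [∀ i, IsProbabilityMeasure (π i)]
    (h : ∀ i, (π i).map Prod.snd = ν) :
    ∃ γ : ProbabilityMeasure (B × ∀ i, A i), (γ : Measure (B × ∀ i, A i)).map Prod.fst = ν ∧
      ∀ i, (γ : Measure (B × ∀ i, A i)).map (fun p => (p.2 i, p.1)) = π i := by
  have : ∀ i, Nonempty (A i) := fun i =>
    (nonempty_of_isProbabilityMeasure (π i)).map Prod.fst
  have hp : ∀ i, IsProbabilityMeasure ((π i).map Prod.swap) := fun i =>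
    Measure.isProbabilityMeasure_map measurable_swap.aemeasurable
  -- Disintegrate each coupling over `B` and make the coordinates conditionally independent given
  -- the point of `B`.
  refine ⟨⟨ν ⊗ₘ piKernel fun i => ((π i).map Prod.swap).condKernel, inferInstance⟩,
    Measure.fst_compProd _ _, fun i => ?_⟩
  have h1 : ν ⊗ₘ ((π i).map Prod.swap).condKernel = (π i).map Prod.swap := by
    have h2 := ((π i).map Prod.swap).disintegrate ((π i).map Prod.swap).condKernel
    rwa [Measure.fst_map_swap, Measure.snd, h i] at h2
  rw [← piKernel_map_eval (fun i => ((π i).map Prod.swap).condKernel) i,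
    Measure.compProd_map (measurable_pi_apply i)] at h1
  have h3 := congrArg (Measure.map Prod.swap) h1
  rw [Measure.map_map measurable_swap measurable_swap, Prod.swap_swap_eq, Measure.map_id,
    Measure.map_map measurable_swap (by fun_prop)] at h3
  exact h3

end Gluing

/-! ### Supports, and isometries between them -/

section Support

variable {A B C : Type*} [TopologicalSpace A] [SecondCountableTopology A] [MeasurableSpace A]

/-- Continuous functions that agree almost everywhere agree on the support. -/
theorem eq_on_support_of_ae_eq (γ : Measure A) [IsProbabilityMeasure γ] {F G : A × A → ℝ}
    (hF : Continuous F) (hG : Continuous G) (h : F =ᵐ[γ.prod γ] G) {p q : A}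
    (hp : p ∈ γ.support) (hq : q ∈ γ.support) : F (p, q) = G (p, q) := by
  have hcl : IsClosed {z | F z = G z} := isClosed_eq hF hG
  -- Neighbourhoods of `(p, q)` contain products of neighbourhoods, whose mass is a product of
  -- positive numbers.
  have hmem : (p, q) ∈ (γ.prod γ).support := by
    rw [Measure.mem_support_iff_forall]
    intro U hU
    obtain ⟨V, hV, W, hW, hVW⟩ := mem_nhds_prod_iff.1 hU
    refine lt_of_lt_of_le ?_ (measure_mono hVW)
    rw [Measure.prod_prod]
    exact ENNReal.mul_pos ((Measure.mem_support_iff_forall p).1 hp V hV).ne'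
      ((Measure.mem_support_iff_forall q).1 hq W hW).ne'
  exact Measure.support_subset_of_isClosed hcl h hmem

/-- The support is compact, so its image is closed; as it has full measure for the push-forward, it
contains the support of the latter. -/
theorem image_support_eq [CompactSpace A] [BorelSpace A] [TopologicalSpace B] [T2Space B] [MeasurableSpace B] [BorelSpace B]
    (γ : Measure A) {f : A → B} (hf : Continuous f) :
    f '' γ.support = (γ.map f).support := by
  apply Set.Subset.antisymm
  · rintro _ ⟨p, hp, rfl⟩
    rw [Measure.mem_support_iff_forall]
    intro U hU
    exact lt_of_lt_of_le ((Measure.mem_support_iff_forall p).1 hp _ (hf.continuousAt hU))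
      (Measure.le_map_apply hf.measurable.aemeasurable U)
  · have hcl : IsClosed (f '' γ.support) :=
      (Measure.isClosed_support.isCompact.image hf).isClosed
    refine Measure.support_subset_of_isClosed hcl ?_
    rw [mem_ae_map_iff hf.measurable.aemeasurable hcl.measurableSet]
    exact mem_of_superset Measure.support_mem_ae (Set.subset_preimage_image f _)

/-- If two maps to metric spaces pull the distances back to the same function on the support of
`γ`, the images of `γ` are isomorphic. -/
theorem exists_isometryEquiv_support [CompactSpace A] [BorelSpace A]
    [MetricSpace B] [MeasurableSpace B] [BorelSpace B]
    [MetricSpace C] [MeasurableSpace C] [BorelSpace C] (γ : Measure A)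
    {f : A → B} (hf : Continuous f) {g : A → C} (hg : Continuous g)
    {μ : Measure B} (hμ : γ.map f = μ) {ν : Measure C} (hν : γ.map g = ν)
    (h : ∀ p ∈ γ.support, ∀ q ∈ γ.support, dist (f p) (f q) = dist (g p) (g q)) :
    ∃ e : μ.support ≃ᵢ ν.support, (μ.comap Subtype.val).map e = ν.comap Subtype.val := by
  subst hμ hν
  have hfs := image_support_eq γ hf
  have hgs := image_support_eq γ hg
  have hex : ∀ x : (γ.map f).support, ∃ p ∈ γ.support, f p = x := fun x => by
    exact hfs.symm.subset x.2
  choose r hr hfr using hex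
  have hmem : ∀ p ∈ γ.support, g p ∈ (γ.map g).support := fun p hp => by
    rw [← hgs]; exact ⟨p, hp, rfl⟩
  have hmem' : ∀ p ∈ γ.support, f p ∈ (γ.map f).support := fun p hp => by
    rw [← hfs]; exact ⟨p, hp, rfl⟩
  -- The isometry sends `f p` to `g p`. The choice of `p` in the fibre is immaterial, since `f p = f
  -- q` forces `dist (g p) (g q) = 0`; this is `hFg`.
  let F : (γ.map f).support → (γ.map g).support := fun x => ⟨g (r x), hmem _ (hr x)⟩
  have hF : Isometry F := Isometry.of_dist_eq fun x y => by
    rw [Subtype.dist_eq, Subtype.dist_eq, ← h _ (hr x) _ (hr y), hfr, hfr]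
  have hFg : ∀ p (hp : p ∈ γ.support), F ⟨f p, hmem' p hp⟩ = ⟨g p, hmem p hp⟩ := fun p hp => by
    apply Subtype.ext
    apply dist_eq_zero.1
    change dist (g (r ⟨f p, hmem' p hp⟩)) (g p) = 0
    rw [← h _ (hr _) _ hp, hfr, dist_self]
  have hsurj : Function.Surjective F := fun y => by
    obtain ⟨p, hp, hpy⟩ := hgs.symm.subset y.2
    exact ⟨⟨f p, hmem' p hp⟩, (hFg p hp).trans (Subtype.ext hpy)⟩
  let e : (γ.map f).support ≃ᵢ (γ.map g).support :=
    ⟨Equiv.ofBijective F ⟨hF.injective, hsurj⟩, hF⟩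
  have heF : ⇑e = F := rfl
  refine ⟨e, ?_⟩
  have hmf : MeasurableSet (γ.map f).support := Measure.isClosed_support.measurableSet
  have hmg : MeasurableSet (γ.map g).support := Measure.isClosed_support.measurableSet
  ext s hs
  have hs' : MeasurableSet (F ⁻¹' s) := hF.continuous.measurable hs
  rw [heF, Measure.map_apply hF.continuous.measurable hs,
    (MeasurableEmbedding.subtype_coe hmf).comap_apply,
    (MeasurableEmbedding.subtype_coe hmg).comap_apply,
    Measure.map_apply hf.measurable (hmf.subtype_image hs'),
    Measure.map_apply hg.measurable (hmg.subtype_image hs)]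
  -- The two preimages in `A` coincide on the support of `γ`, hence up to a null set.
  refine measure_congr ?_
  filter_upwards [Measure.support_mem_ae (μ := γ)] with p hp
  refine propext ?_
  change f p ∈ Subtype.val '' (F ⁻¹' s) ↔ g p ∈ Subtype.val '' s
  constructor
  · rintro ⟨x, hx, hxp⟩
    obtain rfl : x = ⟨f p, hmem' p hp⟩ := Subtype.ext hxp
    rw [Set.mem_preimage, hFg p hp] at hx
    exact ⟨_, hx, rfl⟩
  · rintro ⟨y, hy, hyp⟩
    obtain rfl : y = ⟨g p, hmem p hp⟩ := Subtype.ext hyp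
    refine ⟨⟨f p, hmem' p hp⟩, ?_, rfl⟩
    rwa [Set.mem_preimage, hFg p hp]

end Support

/-- The weighted mean splits the weighted square distance to any point. -/
theorem sum_mul_sub_sq {N : ℕ} (w a : Fin N → ℝ) (hw : ∑ i, w i = 1) (t : ℝ) :
    ∑ i, w i * |a i - t| ^ 2 =
      1 / 2 * ∑ i, ∑ j, w i * w j * |a i - a j| ^ 2 + (∑ i, w i * a i - t) ^ 2 := by
  simp only [sq_abs]
  -- With `M` the mean and `Q` the mean of the squares, both sides equal `Q - 2 * t * M + t ^ 2`;
  -- the double sum is `2 * Q - 2 * M ^ 2`.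
  have h1 : ∑ i, w i * (a i - t) ^ 2 = ∑ i, w i * a i ^ 2 - 2 * t * ∑ i, w i * a i + t ^ 2 := by
    calc _ = ∑ i, (w i * a i ^ 2 - 2 * t * (w i * a i) + w i * t ^ 2) :=
          Finset.sum_congr rfl fun i _ => by ring
      _ = _ := by
          rw [Finset.sum_add_distrib, Finset.sum_sub_distrib, ← Finset.mul_sum, ← Finset.sum_mul,
            hw, one_mul]
  have h2 : ∀ i, ∑ j, w i * w j * (a i - a j) ^ 2 =
      w i * (∑ j, w j * a j ^ 2 - 2 * a i * ∑ j, w j * a j + a i ^ 2) := fun i => by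
    calc _ = ∑ j, w i * (w j * a j ^ 2 - 2 * a i * (w j * a j) + w j * a i ^ 2) :=
          Finset.sum_congr rfl fun j _ => by ring
      _ = _ := by
          rw [← Finset.mul_sum, Finset.sum_add_distrib, Finset.sum_sub_distrib, ← Finset.mul_sum,
            ← Finset.sum_mul, hw, one_mul]
  have h3 : ∑ i, ∑ j, w i * w j * (a i - a j) ^ 2 =
      2 * ∑ i, w i * a i ^ 2 - 2 * (∑ i, w i * a i) ^ 2 := by
    simp only [h2]
    generalize hM : ∑ j, w j * a j = M
    generalize hQ : ∑ j, w j * a j ^ 2 = Q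
    calc _ = ∑ i, (w i * Q - 2 * M * (w i * a i) + w i * a i ^ 2) :=
          Finset.sum_congr rfl fun i _ => by ring
      _ = _ := by
          rw [Finset.sum_add_distrib, Finset.sum_sub_distrib, ← Finset.mul_sum, ← Finset.sum_mul,
            hw, hM, hQ]
          ring
  rw [h1, h3]
  ring

/-! ### Optimal plans for two spaces -/

theorem continuous_distortion (X Y : MMSpace.{u}) :
    Continuous fun p : (X × Y) × (X × Y) => |dist p.1.1 p.2.1 - dist p.1.2 p.2.2| ^ 2 := by
  fun_prop

theorem GW_nonneg (X Y : MMSpace.{u}) : 0 ≤ GW X Y :=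
  Real.sInf_nonneg <| by rintro _ ⟨π, -, rfl⟩; exact Real.sqrt_nonneg _

/-- Every transport plan bounds the squared Gromov--Wasserstein distance. -/
theorem GW_sq_le (X Y : MMSpace.{u}) {π : ProbabilityMeasure (X × Y)} (hπ : π ∈ couplings X Y) :
    GW X Y ^ 2 ≤ ∫ p : (X × Y) × (X × Y), |dist p.1.1 p.2.1 - dist p.1.2 p.2.2| ^ 2
      ∂((π : Measure (X × Y)).prod (π : Measure (X × Y))) := by
  have h0 : BddBelow ((fun π : ProbabilityMeasure (X × Y) =>
      Real.sqrt (∫ p : (X × Y) × (X × Y), |dist p.1.1 p.2.1 - dist p.1.2 p.2.2| ^ 2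
        ∂((π : Measure (X × Y)).prod (π : Measure (X × Y))))) '' couplings X Y) :=
    ⟨0, by rintro _ ⟨π, -, rfl⟩; exact Real.sqrt_nonneg _⟩
  calc GW X Y ^ 2 ≤ Real.sqrt _ ^ 2 :=
        pow_le_pow_left₀ (GW_nonneg X Y) (csInf_le h0 ⟨π, hπ, rfl⟩) 2
    _ = _ := Real.sq_sqrt (integral_nonneg fun p => by positivity)

theorem isClosed_couplings (X Y : MMSpace.{u}) : IsClosed (couplings X Y) :=
  (isClosed_setOf_map_eq continuous_fst X.μ).inter (isClosed_setOf_map_eq continuous_snd Y.μ)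

theorem couplings_nonempty (X Y : MMSpace.{u}) : (couplings X Y).Nonempty :=
  ⟨X.μ.prod Y.μ, by
    constructor
    · exact Measure.fst_prod
    · exact Measure.snd_prod⟩

/-- Optimal transport plans exist. -/
theorem exists_GW_sq_eq (X Y : MMSpace.{u}) : ∃ π ∈ couplings X Y,
    GW X Y ^ 2 = ∫ p : (X × Y) × (X × Y), |dist p.1.1 p.2.1 - dist p.1.2 p.2.2| ^ 2
      ∂((π : Measure (X × Y)).prod (π : Measure (X × Y))) := by
  obtain ⟨π, hπ, hmin⟩ := exists_minimizer_integral_prod_self (continuous_distortion X Y)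
    (isClosed_couplings X Y) (couplings_nonempty X Y)
  refine ⟨π, hπ, ?_⟩
  have h : GW X Y = Real.sqrt (∫ p : (X × Y) × (X × Y),
      |dist p.1.1 p.2.1 - dist p.1.2 p.2.2| ^ 2
      ∂((π : Measure (X × Y)).prod (π : Measure (X × Y)))) := by
    refine IsLeast.csInf_eq ⟨⟨π, hπ, rfl⟩, ?_⟩
    rintro _ ⟨γ, hγ, rfl⟩
    exact Real.sqrt_le_sqrt (hmin γ hγ)
  rw [h, Real.sq_sqrt (integral_nonneg fun p => by positivity)]

/-! ### Barycenters and the multi-marginal problem -/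

section Multi

variable {N : ℕ} (X : Fin N → MMSpace.{u}) (ρ : Fin N → ℝ≥0)

theorem continuous_baryCost :
    Continuous fun p : (∀ i, X i) × (∀ i, X i) => baryCost X ρ p.1 p.2 := by
  unfold baryCost
  fun_prop

/-- Minimizers of the multi-marginal problem exist. -/
theorem exists_isMGWMinimizer : ∃ π, IsMGWMinimizer X (baryCost X ρ) π := by
  have hcl : IsClosed (multiCouplings X) := by
    have : multiCouplings X = ⋂ i, {π : ProbabilityMeasure (∀ i, X i) |
        (π : Measure (∀ i, X i)).map (fun x => x i) = (X i).μ} := by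
      ext; simp [multiCouplings]
    rw [this]
    exact isClosed_iInter fun i => isClosed_setOf_map_eq (continuous_apply i) _
  have hne : (multiCouplings X).Nonempty :=
    ⟨ProbabilityMeasure.pi fun i => (X i).μ, fun i =>
      (measurePreserving_eval (fun i => ((X i).μ : Measure (X i))) i).map_eq⟩
  obtain ⟨π, hπ, hmin⟩ :=
    exists_minimizer_integral_prod_self (continuous_baryCost X ρ) hcl hne
  exact ⟨π, hπ, hmin⟩

theorem sum_distortion_eq (hρ : ∑ i, ρ i = 1) (x x' : ∀ i, X i) (t : ℝ) :
    ∑ i, (ρ i : ℝ) * |dist (x i) (x' i) - t| ^ 2 =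
      baryCost X ρ x x' + (dist (toStar X ρ x) (toStar X ρ x') - t) ^ 2 :=
  sum_mul_sub_sq (fun i => (ρ i : ℝ)) (fun i => dist (x i) (x' i)) (by exact_mod_cast hρ) t

/-- The barycenter objective of `(X₁ × ⋯ × X_N, d*, π)` is at most the transport cost of `π`. -/
theorem baryObjective_starSpace_le (hρ : ∑ i, ρ i = 1) {π : ProbabilityMeasure (∀ i, X i)}
    (hπ : π ∈ multiCouplings X) :
    baryObjective X ρ (starSpace X ρ π) ≤ mgwObjective X (baryCost X ρ) π := by
  have hf : ∀ i, Continuous fun x : ∀ i, X i =>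
      ((x i, toStar X ρ x) : X i × (starSpace X ρ π)) := fun i =>
    (continuous_apply i).prodMk (continuous_toStar X ρ)
  have key : ∀ i, GW (X i) (starSpace X ρ π) ^ 2 ≤
      ∫ p : (∀ i, X i) × (∀ i, X i), |dist (p.1 i) (p.2 i) -
        dist (toStar X ρ p.1) (toStar X ρ p.2)| ^ 2
        ∂((π : Measure (∀ i, X i)).prod (π : Measure (∀ i, X i))) := fun i => by
    -- The graph-like map `x ↦ (x i, toStar x)` turns `π` into an admissible, not necessarily
    -- optimal, coupling.
    have hmem : π.map (hf i).measurable.aemeasurable ∈ couplings (X i) (starSpace X ρ π) := by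
      constructor
      · rw [ProbabilityMeasure.toMeasure_map, Measure.map_map measurable_fst (hf i).measurable]
        exact hπ i
      · rw [ProbabilityMeasure.toMeasure_map, Measure.map_map measurable_snd (hf i).measurable]
        rfl
    refine (GW_sq_le _ _ hmem).trans_eq ?_
    rw [ProbabilityMeasure.toMeasure_map]
    exact integral_prod_self_map _ (hf i) (continuous_distortion _ _)
  have hc := continuous_toStar X ρ
  calc baryObjective X ρ (starSpace X ρ π)
      ≤ ∑ i, (ρ i : ℝ) * ∫ p : (∀ i, X i) × (∀ i, X i), |dist (p.1 i) (p.2 i) -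
        dist (toStar X ρ p.1) (toStar X ρ p.2)| ^ 2
        ∂((π : Measure (∀ i, X i)).prod (π : Measure (∀ i, X i))) :=
        Finset.sum_le_sum fun i _ => mul_le_mul_of_nonneg_left (key i) (ρ i).2
    _ = mgwObjective X (baryCost X ρ) π := by
        simp_rw [← integral_const_mul]
        rw [← integral_finsetSum _ fun i _ => integrable_prod_self _ (by fun_prop)]
        refine integral_congr_ae (Eventually.of_forall fun p => ?_)
        -- Here `t` is the `d*`-distance itself, so only the variance term survives.
        simp only [sum_distortion_eq X ρ hρ, sub_self]
        simp

/-- Gluing optimal plans to `Y` splits the barycenter objective of `Y` into the transport cost of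
a multi-marginal plan and the distortion between `Y` and `d*`. -/
theorem exists_plan_baryObjective_eq (hρ : ∑ i, ρ i = 1) (Y : MMSpace.{u}) :
    ∃ γ : ProbabilityMeasure (Y × ∀ i, X i),
      (γ : Measure (Y × ∀ i, X i)).map Prod.fst = Y.μ ∧
      γ.map measurable_snd.aemeasurable ∈ multiCouplings X ∧
      baryObjective X ρ Y =
        mgwObjective X (baryCost X ρ) (γ.map measurable_snd.aemeasurable) +
        ∫ p : (Y × ∀ i, X i) × (Y × ∀ i, X i),
          (dist (toStar X ρ p.1.2) (toStar X ρ p.2.2) - dist p.1.1 p.2.1) ^ 2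
          ∂((γ : Measure (Y × ∀ i, X i)).prod (γ : Measure (Y × ∀ i, X i))) := by
  -- Optimality of these plans makes the final formula an equality.
  choose π hπ hGW using fun i => exists_GW_sq_eq (X i) Y
  obtain ⟨γ, hfst, hγπ⟩ := exists_gluing (Y.μ : Measure Y)
    (fun i => (π i : Measure (X i × Y))) fun i => (hπ i).2
  have hc := continuous_toStar X ρ
  have hcost := continuous_baryCost X ρ
  have hg : ∀ i, Continuous fun p : Y × (∀ i, X i) => ((p.2 i, p.1) : X i × Y) := fun i => by
    fun_prop
  refine ⟨γ, hfst, fun i => ?_, ?_⟩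
  · rw [ProbabilityMeasure.toMeasure_map, Measure.map_map (measurable_pi_apply i) measurable_snd, ← (hπ i).1, ← hγπ i,
      Measure.map_map measurable_fst (hg i).measurable]
    rfl
  · have h1 : ∀ i, GW (X i) Y ^ 2 = ∫ p : (Y × ∀ i, X i) × (Y × ∀ i, X i),
        |dist (p.1.2 i) (p.2.2 i) - dist p.1.1 p.2.1| ^ 2 ∂((γ : Measure (Y × ∀ i, X i)).prod γ) := fun i => by
      rw [hGW i, ← hγπ i]
      exact integral_prod_self_map _ (hg i) (continuous_distortion _ _)
    have h2 : mgwObjective X (baryCost X ρ) (γ.map measurable_snd.aemeasurable) =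
        ∫ p : (Y × ∀ i, X i) × (Y × ∀ i, X i), baryCost X ρ p.1.2 p.2.2
          ∂((γ : Measure (Y × ∀ i, X i)).prod γ) := by
      rw [mgwObjective, ProbabilityMeasure.toMeasure_map]
      exact integral_prod_self_map (γ : Measure (Y × ∀ i, X i)) continuous_snd hcost
    have h3 : Continuous fun p : (Y × ∀ i, X i) × (Y × ∀ i, X i) => baryCost X ρ p.1.2 p.2.2 := by
      unfold baryCost
      fun_prop
    have h4 : Continuous fun p : (Y × ∀ i, X i) × (Y × ∀ i, X i) =>
        (dist (toStar X ρ p.1.2) (toStar X ρ p.2.2) - dist p.1.1 p.2.1) ^ 2 := by fun_prop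
    rw [h2, ← integral_add (integrable_prod_self _ h3) (integrable_prod_self _ h4)]
    unfold baryObjective
    simp_rw [h1, ← integral_const_mul]
    rw [← integral_finsetSum _ fun i _ => integrable_prod_self _ (by fun_prop)]
    exact integral_congr_ae (Eventually.of_forall fun p => sum_distortion_eq X ρ hρ _ _ _)

theorem isBarycenter_starSpace (hρ : ∑ i, ρ i = 1) {π : ProbabilityMeasure (∀ i, X i)}
    (hπ : IsMGWMinimizer X (baryCost X ρ) π) : IsBarycenter X ρ (starSpace X ρ π) := fun Z => by
  obtain ⟨γ, -, hγ, hZ⟩ := exists_plan_baryObjective_eq X ρ hρ Z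
  rw [hZ]
  refine ((baryObjective_starSpace_le X ρ hρ hπ.1).trans (hπ.2 _ hγ)).trans ?_
  exact le_add_of_nonneg_right (integral_nonneg fun p => sq_nonneg _)

theorem exists_isomorphic_starSpace (hρ : ∑ i, ρ i = 1) {Y : MMSpace.{u}}
    (hY : IsBarycenter X ρ Y) : ∃ π : ProbabilityMeasure (∀ i, X i),
      IsMGWMinimizer X (baryCost X ρ) π ∧ Y.Isomorphic (starSpace X ρ π) := by
  obtain ⟨π, hπ⟩ := exists_isMGWMinimizer X ρ
  obtain ⟨γ, hfst, hγ, hobj⟩ := exists_plan_baryObjective_eq X ρ hρ Y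
  have hle := (hY (starSpace X ρ π)).trans (baryObjective_starSpace_le X ρ hρ hπ.1)
  have hge := hπ.2 _ hγ
  have hc := continuous_toStar X ρ
  have hcont : Continuous fun p : (Y × ∀ i, X i) × (Y × ∀ i, X i) =>
      (dist (toStar X ρ p.1.2) (toStar X ρ p.2.2) - dist p.1.1 p.2.1) ^ 2 := by fun_prop
  have hnn : 0 ≤ fun p : (Y × ∀ i, X i) × (Y × ∀ i, X i) =>
      (dist (toStar X ρ p.1.2) (toStar X ρ p.2.2) - dist p.1.1 p.2.1) ^ 2 :=
    fun p => sq_nonneg _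
  have hint := integral_nonneg (μ := (γ : Measure (Y × ∀ i, X i)).prod γ) hnn
  refine ⟨γ.map measurable_snd.aemeasurable, ⟨hγ, fun η hη => ?_⟩, ?_⟩
  · have := hπ.2 η hη
    linarith
  · have hzero : ∫ p : (Y × ∀ i, X i) × (Y × ∀ i, X i),
        (dist (toStar X ρ p.1.2) (toStar X ρ p.2.2) - dist p.1.1 p.2.1) ^ 2
        ∂((γ : Measure (Y × ∀ i, X i)).prod (γ : Measure (Y × ∀ i, X i))) = 0 :=
      -- Cost plus distortion is at most the minimal cost, while the cost alone is at least that.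
      le_antisymm (by linarith) hint
    have hae := (integral_eq_zero_iff_of_nonneg hnn (integrable_prod_self _ hcont)).1 hzero
    have hg : Continuous fun p : Y × (∀ i, X i) => toStar X ρ p.2 := by fun_prop
    have hsnd : (γ : Measure (Y × ∀ i, X i)).map (fun p => toStar X ρ p.2) =
        ((starSpace X ρ (γ.map measurable_snd.aemeasurable)).μ :
          Measure (starSpace X ρ (γ.map measurable_snd.aemeasurable))) :=
      (Measure.map_map (measurable_toStar X ρ) measurable_snd).symm
    refine exists_isometryEquiv_support (γ : Measure (Y × ∀ i, X i)) continuous_fst hg hfst hsnd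
      fun p hp q hq => ?_
    -- Continuity upgrades almost everywhere vanishing of the distortion to vanishing at all pairs
    -- in the support.
    have h := eq_on_support_of_ae_eq _ hcont continuous_const hae hp hq
    exact (sub_eq_zero.1 (pow_eq_zero_iff two_ne_zero |>.1 h)).symm

end Multi

end GromovWasserstein

theorem mainTheorem1 {N : ℕ} (X : Fin N → GromovWasserstein.MMSpace.{u})
    (ρ : Fin N → ℝ≥0) (hρ : ∑ i, ρ i = 1) :
    (∃ Y : GromovWasserstein.MMSpace.{u}, GromovWasserstein.IsBarycenter X ρ Y) ∧
    ∀ Y : GromovWasserstein.MMSpace.{u}, GromovWasserstein.IsBarycenter X ρ Y →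
      ∃ π : ProbabilityMeasure (∀ i, X i),
        GromovWasserstein.IsMGWMinimizer X (GromovWasserstein.baryCost X ρ) π ∧
        Y.Isomorphic (GromovWasserstein.starSpace X ρ π) := by
  obtain ⟨π, hπ⟩ := GromovWasserstein.exists_isMGWMinimizer X ρ
  exact ⟨⟨_, GromovWasserstein.isBarycenter_starSpace X ρ hρ hπ⟩,
    fun Y hY => GromovWasserstein.exists_isomorphic_starSpace X ρ hρ hY⟩
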